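/- **Setting.** Let $K,N\ge 1$ be integers. A server stores $N$ independent files $W_1,\dots,W_N$, each uniformly distributed on $[2^F]$ (that is, $F$ bits), and is connected to $K$ users by an error-free multicast link. User $k$ has a cache of normalized size $m_k\in[0,1]$, i.e. of $M_kF$ bits with $M_k=Nm_k$; write $\boldsymbol m=(m_1,\dots,m_K)$. A caching scheme with signal lengths $v_{\mathcal T}\ge 0$, $\emptyset\ne\mathcal T\subseteq[K]$, consists of * (arbitrary, possibly coded) placement functions $\varphi_k:[2^F]^N\to[2^{\lfloor M_kF\rfloor}]$, giving the cache contents $Z_k=\varphi_k(W_1,\dots,W_N)$, chosen independently of the demands; * for every demand vector $\boldsymbol d\in[N]^K$ and every non-empty $\mathcal T\subseteq[K]$ an encoding function $\psi_{\mathcal T,\boldsymbol d}:[2^F]^K\to[2^{\lfloor v_{\mathcal T}F\rfloor}]$, giving the transmitted signal $X_{\mathcal T,\boldsymbol d}=\psi_{\mathcal T,\boldsymbol d}(W_{d_1},\dots,W_{d_K})$; * decoding functions $\mu_{\boldsymbol d,k}$, giving the estimate $\hat W_{d_k}=\mu_{\boldsymbol d,k}\big((X_{\mathcal T,\boldsymbol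 d})_{\emptyset\ne\mathcal T\subseteq[K]},Z_k\big)\in[2^F]$ of user $k$. A delivery load $R$ is *achievable* for $\boldsymbol m$ if for every $\epsilon>0$ and all sufficiently large $F$ there is such a scheme with $\sum_{\emptyset\ne\mathcal T\subseteq[K]}v_{\mathcal T}=R$ and $\max_{\boldsymbol d,\,k}\Pr(\hat W_{d_k}\ne W_{d_k})\le\epsilon$. Let $R^*(\boldsymbol m)=\inf\{R: R\text{ is achievable for }\boldsymbol m\}$. **Proposition.** If $m_1\le m_2\le\dots\le m_K$, then $$R^*(\boldsymbol m)\ \ge\ \max\left\{\ \max_{1\le s\le\min\{K,N\}}\left\{s-\sum_{k=1}^{s}\frac{N\sum_{i=1}^{k}m_i}{N-k+1}\right\},\ \ \max_{1\le s\le\min\{K,N\}}\left\{s\Big(1-\sum_{i=1}^{s}m_i\Big)\right\}\ \right\}.$$ -/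

import Mathlib

open Filter

namespace CodedCaching

/-- A realization of the library: `N` files of `F` bits each. -/
abbrev Library (N F : ℕ) : Type := Fin N → Fin (2 ^ F)

/-- The non-empty subsets of the users; each of them indexes one multicast signal. -/
abbrev UserGroup (K : ℕ) : Type := {T : Finset (Fin K) // T.Nonempty}

/-- A caching scheme for `K` users, `N` files of `F` bits, normalized cache sizes `m`
(user `k` stores `⌊N * m k * F⌋` bits) and signal lengths `v` (the signal for the group `T`
has `⌊v T * F⌋` bits). The placement is arbitrary (possibly coded) and is chosen without
knowledge of the demands. -/
structure CachingScheme (K N F : ℕ) (m : Fin K → ℝ) (v : UserGroup K → ℝ) where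
  /-- `placement k W` is the cache content of user `k`. -/
  placement : (k : Fin K) → Library N F → Fin (2 ^ ⌊(N : ℝ) * m k * (F : ℝ)⌋₊)
  /-- `encode T d w` is the signal for the group `T` under the demand vector `d`, computed
  from the requested files `w = (W_{d_1}, …, W_{d_K})`. -/
  encode : (T : UserGroup K) → (d : Fin K → Fin N) → (Fin K → Fin (2 ^ F)) →
    Fin (2 ^ ⌊v T * (F : ℝ)⌋₊)
  /-- `decode d k X Z` is the estimate of the requested file by user `k`, from all the
  signals `X` and the content `Z` of the user's own cache. -/
  decode : (d : Fin K → Fin N) → (k : Fin K) →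
    ((T : UserGroup K) → Fin (2 ^ ⌊v T * (F : ℝ)⌋₊)) →
    Fin (2 ^ ⌊(N : ℝ) * m k * (F : ℝ)⌋₊) → Fin (2 ^ F)

namespace CachingScheme

variable {K N F : ℕ} {m : Fin K → ℝ} {v : UserGroup K → ℝ}

/-- The file that user `k` reconstructs when the library is `W` and the demands are `d`. -/
def output (S : CachingScheme K N F m v) (d : Fin K → Fin N) (k : Fin K)
    (W : Library N F) : Fin (2 ^ F) :=
  S.decode d k (fun T => S.encode T d (fun j => W (d j))) (S.placement k W)

/-- The probability that user `k` decodes incorrectly under the demand vector `d`, for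
independent files, each uniformly distributed on the `2 ^ F` bit strings of length `F`. -/
noncomputable def errorProb (S : CachingScheme K N F m v) (d : Fin K → Fin N)
    (k : Fin K) : ℝ :=
  ((Finset.univ.filter fun W : Library N F => S.output d k W ≠ W (d k)).card : ℝ) /
    (Fintype.card (Library N F) : ℝ)

end CachingScheme

/-- The delivery load `R` is achievable: for every `ε > 0` and all large enough file sizes `F`
there is a scheme with total signal length `∑ v T = R` for which all users decode with error
probability at most `ε` under all demand vectors. -/
def Achievable (K N : ℕ) (m : Fin K → ℝ) (R : ℝ) : Prop :=
  ∀ ε : ℝ, 0 < ε → ∀ᶠ F : ℕ in atTop,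
    ∃ v : UserGroup K → ℝ, (∀ T, 0 ≤ v T) ∧ ∑ T, v T = R ∧
      ∃ S : CachingScheme K N F m v, ∀ d k, S.errorProb d k ≤ ε

/-- The minimum worst-case delivery load `R^*(m)`. -/
noncomputable def optimalLoad (K N : ℕ) (m : Fin K → ℝ) : ℝ :=
  sInf {R : ℝ | Achievable K N m R}

/-- `m_1 + … + m_k`, the total normalized cache size of the first `k` users. -/
noncomputable def cacheSum {K : ℕ} (m : Fin K → ℝ) (k : ℕ) : ℝ :=
  ∑ i : Fin K with i.val < k, m i

end CodedCaching

/-! Fix a scheme and let users decode successively from one common set of signals, user `k` being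
granted the caches in a growing set `A k`. By submodularity and Fano, the signals' entropy is at
least the sum of the conditional entropies of the newly decoded files given the earlier files and `A
k`, up to a small error (`sum_condEntropy_le`). Demands may depend on the placement, so each new
file is chosen greedily, with at least the average conditional entropy of the remaining ones
(`exists_greedy_sequence`). Growing cache sets give the first bound; granting all `s` caches from
the start gives the second, as the sum telescopes. `le_of_achievable` removes the Fano error by
taking `F` large. -/

namespace CodedCaching

/-! ### Entropy on a finite uniform space -/

section Entropy

variable {Ω α β γ : Type*} [Fintype Ω]

open Classical in
/-- The number of outcomes at which `f` takes the same value as at `ω`. -/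
noncomputable def fiberCard (f : Ω → α) (ω : Ω) : ℕ :=
  (Finset.univ.filter fun ω' => f ω' = f ω).card

/-- The Shannon entropy, in nats, of `f` under the uniform distribution on `Ω`. -/
noncomputable def entropy (f : Ω → α) : ℝ :=
  (∑ ω, Real.log (Fintype.card Ω / fiberCard f ω)) / Fintype.card Ω

lemma fiberCard_pos (f : Ω → α) (ω : Ω) : 0 < fiberCard f ω :=
  Finset.card_pos.mpr ⟨ω, by simp⟩

lemma entropy_le_of_determines {f : Ω → α} {g : Ω → β}
    (h : ∀ ω ω', g ω = g ω' → f ω = f ω') : entropy f ≤ entropy g := by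
  classical
  unfold entropy
  gcongr with ω
  · have : 0 < Fintype.card Ω := Fintype.card_pos_iff.mpr ⟨ω⟩
    have := fiberCard_pos f ω
    positivity
  · exact_mod_cast fiberCard_pos g ω
  · refine Finset.card_le_card fun ω' => ?_
    simpa using h ω' ω

lemma entropy_eq_of_determines {f : Ω → α} {g : Ω → β}
    (h : ∀ ω ω', g ω = g ω' ↔ f ω = f ω') : entropy f = entropy g :=
  le_antisymm (entropy_le_of_determines fun ω ω' => (h ω ω').1)
    (entropy_le_of_determines fun ω ω' => (h ω ω').2)

/-- Each summand is `q` divided by the true conditional probability of `f` given `y`, so the average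
is the total `q`-mass of the values that occur. Writing `fiberCard y ω` as a count of `ω'` and
swapping the sums leaves at most one unit of mass per `ω'`. -/
lemma sum_weight_div_fiberCard_le [Fintype α] (f : Ω → α) (y : Ω → β) (q : β → α → ℝ)
    (hq0 : ∀ b a, 0 ≤ q b a) (hq1 : ∀ b, ∑ a, q b a ≤ 1) :
    ∑ ω, q (y ω) (f ω) * fiberCard y ω / fiberCard (fun ω => (f ω, y ω)) ω
      ≤ Fintype.card Ω := by
  classical
  have expand : ∀ ω, q (y ω) (f ω) * fiberCard y ω / fiberCard (fun ω => (f ω, y ω)) ω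
      = ∑ ω', if y ω' = y ω then q (y ω) (f ω) / fiberCard (fun ω => (f ω, y ω)) ω else 0 := by
    intro ω
    rw [← Finset.sum_filter, Finset.sum_const, nsmul_eq_mul]
    unfold fiberCard
    ring
  simp_rw [expand]
  rw [Finset.sum_comm]
  calc _ ≤ ∑ _ω' : Ω, (1 : ℝ) := by
        refine Finset.sum_le_sum fun ω' _ => ?_
        rw [← Finset.sum_fiberwise (s := Finset.univ) (g := f)]
        refine le_trans (Finset.sum_le_sum fun a _ => ?_) (hq1 (y ω'))
        rw [← Finset.sum_filter, Finset.filter_filter]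
        have hc : ∀ ω ∈ Finset.univ.filter (fun ω => f ω = a ∧ y ω' = y ω),
            q (y ω) (f ω) / fiberCard (fun ω => (f ω, y ω)) ω
            = q (y ω') a / (Finset.univ.filter (fun ω => f ω = a ∧ y ω' = y ω)).card := by
          intro ω hω
          simp only [Finset.mem_filter, Finset.mem_univ, true_and] at hω
          obtain ⟨rfl, hy⟩ := hω
          rw [hy]
          congr 2
          unfold fiberCard
          congr 1
          ext ω''
          simp [eq_comm]
        rw [Finset.sum_congr rfl hc, Finset.sum_const, nsmul_eq_mul]
        rcases Nat.eq_zero_or_pos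
          (Finset.univ.filter (fun ω => f ω = a ∧ y ω' = y ω)).card with h0 | h0
        · rw [h0]; simpa using hq0 _ _
        · have : ((Finset.univ.filter (fun ω => f ω = a ∧ y ω' = y ω)).card : ℝ) ≠ 0 := by
            exact_mod_cast h0.ne'
          rw [mul_div_cancel₀ _ this]
    _ = _ := by simp

/-- Gibbs' inequality: a conditional entropy is at most the cross-entropy with respect to any
conditional subprobability mass function. -/
lemma entropy_sub_le_crossEntropy [Fintype α] (f : Ω → α) (y : Ω → β) (q : β → α → ℝ)
    (hq0 : ∀ b a, 0 ≤ q b a) (hq1 : ∀ b, ∑ a, q b a ≤ 1) (hpos : ∀ ω, 0 < q (y ω) (f ω)) :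
    entropy (fun ω => (f ω, y ω)) - entropy y
      ≤ (∑ ω, -Real.log (q (y ω) (f ω))) / Fintype.card Ω := by
  unfold entropy
  rw [← sub_div, ← Finset.sum_sub_distrib]
  gcongr ?_ / _
  rw [← sub_nonpos, ← Finset.sum_sub_distrib]
  have key : ∀ ω, Real.log (Fintype.card Ω / fiberCard (fun ω => (f ω, y ω)) ω)
      - Real.log (Fintype.card Ω / fiberCard y ω) - -Real.log (q (y ω) (f ω))
      ≤ q (y ω) (f ω) * fiberCard y ω / fiberCard (fun ω => (f ω, y ω)) ω - 1 := by
    intro ω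
    have hn : (0 : ℝ) < Fintype.card Ω := by exact_mod_cast Fintype.card_pos_iff.mpr ⟨ω⟩
    have h1 : (0 : ℝ) < fiberCard y ω := by exact_mod_cast fiberCard_pos y ω
    have h2 : (0 : ℝ) < fiberCard (fun ω => (f ω, y ω)) ω := by exact_mod_cast fiberCard_pos _ ω
    have h3 := hpos ω
    refine le_trans (le_of_eq ?_) (Real.log_le_sub_one_of_pos (by positivity))
    rw [Real.log_div hn.ne' h2.ne', Real.log_div hn.ne' h1.ne',
      Real.log_div (by positivity) h2.ne', Real.log_mul h3.ne' h1.ne']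
    ring
  refine (Finset.sum_le_sum fun ω _ => key ω).trans ?_
  rw [Finset.sum_sub_distrib]
  have := sum_weight_div_fiberCard_le f y q hq0 hq1
  simpa using this

lemma entropy_const [Nonempty Ω] (c : α) : entropy (fun _ : Ω => c) = 0 := by
  simp [entropy, fiberCard]

lemma entropy_le_log_card [Nonempty Ω] [Fintype α] (f : Ω → α) :
    entropy f ≤ Real.log (Fintype.card α) := by
  have : Nonempty α := Nonempty.map f ‹_›
  have hα : (0 : ℝ) < Fintype.card α := by exact_mod_cast Fintype.card_pos
  have h := entropy_sub_le_crossEntropy f (fun _ => ())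
    (fun _ _ => (Fintype.card α : ℝ)⁻¹)
    (fun _ _ => by positivity) (fun _ => by simp) (fun _ => by positivity)
  rw [entropy_const, sub_zero] at h
  have hf : entropy f ≤ entropy (fun ω => (f ω, ())) := entropy_le_of_determines (by simp)
  refine hf.trans (h.trans ?_)
  have hn : (Fintype.card Ω : ℝ) ≠ 0 := by exact_mod_cast Fintype.card_ne_zero
  simp [mul_div_cancel_left₀ _ hn]

/-- Conditioning reduces entropy: `H(f | g, h) ≤ H(f | h)`. -/
lemma entropy_submodular [Fintype α] (f : Ω → α) (g : Ω → β) (h : Ω → γ) :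
    entropy (fun ω => (f ω, g ω, h ω)) - entropy (fun ω => (g ω, h ω))
      ≤ entropy (fun ω => (f ω, h ω)) - entropy h := by
  classical
  -- The reference law is the true law of `f` given `h`, ignoring `g`; its cross-entropy is exactly
  -- H(f | h).
  have hG := entropy_sub_le_crossEntropy f (fun ω => (g ω, h ω))
    (fun b a => ((Finset.univ.filter fun ω => f ω = a ∧ h ω = b.2).card : ℝ) /
      (Finset.univ.filter fun ω => h ω = b.2).card)
    (fun _ _ => by positivity)
    (fun b => by
      rw [← Finset.sum_div, ← Nat.cast_sum]
      refine div_le_one_of_le₀ (Nat.cast_le.mpr (le_of_eq ?_)) (Nat.cast_nonneg _)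
      rw [Finset.card_eq_sum_card_fiberwise (f := f) (t := Finset.univ) (by simp)]
      refine Finset.sum_congr rfl fun a _ => ?_
      rw [Finset.filter_filter]
      simp_rw [and_comm])
    (fun ω => by
      refine div_pos ?_ ?_ <;> exact_mod_cast Finset.card_pos.mpr ⟨ω, by simp⟩)
  refine hG.trans (le_of_eq ?_)
  unfold entropy
  rw [← sub_div, ← Finset.sum_sub_distrib]
  congr 1
  refine Finset.sum_congr rfl fun ω _ => ?_
  have hn : (0 : ℝ) < Fintype.card Ω := by exact_mod_cast Fintype.card_pos_iff.mpr ⟨ω⟩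
  have h1 : (0 : ℝ) < fiberCard h ω := by exact_mod_cast fiberCard_pos h ω
  have h2 : (0 : ℝ) < fiberCard (fun ω => (f ω, h ω)) ω := by exact_mod_cast fiberCard_pos _ ω
  have e1 : (Finset.univ.filter fun ω' => h ω' = h ω).card = fiberCard h ω := by
    unfold fiberCard; congr
  have e2 : (Finset.univ.filter fun ω' => f ω' = f ω ∧ h ω' = h ω).card
      = fiberCard (fun ω => (f ω, h ω)) ω := by
    unfold fiberCard; simp
  simp only [e1, e2]
  rw [Real.log_div hn.ne' h2.ne', Real.log_div hn.ne' h1.ne', Real.log_div h2.ne' h1.ne']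
  ring

lemma entropy_pair_le [Nonempty Ω] [Fintype α] (f : Ω → α) (g : Ω → β) :
    entropy (fun ω => (f ω, g ω)) ≤ entropy f + entropy g := by
  have h := entropy_submodular f g (fun _ => ())
  rw [entropy_const, entropy_eq_of_determines (g := fun ω => (f ω, g ω)) (by simp),
    entropy_eq_of_determines (f := fun ω => (g ω, ())) (g := g) (by simp),
    entropy_eq_of_determines (f := fun ω => (f ω, ())) (g := f) (by simp)] at h
  linarith

open Classical in
/-- Fano's inequality, for an estimate `u (y ω)` of `f ω`. -/
lemma fano [Nonempty Ω] [Fintype α] (f : Ω → α) (y : Ω → β) (u : β → α) :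
    entropy (fun ω => (f ω, y ω)) - entropy y
      ≤ Real.log 2 + ((Finset.univ.filter fun ω => u (y ω) ≠ f ω).card : ℝ) / Fintype.card Ω
        * Real.log (Fintype.card α) := by
  have : Nonempty α := Nonempty.map f ‹_›
  have hα : (0 : ℝ) < Fintype.card α := by exact_mod_cast Fintype.card_pos
  have hn : (0 : ℝ) < Fintype.card Ω := by exact_mod_cast Fintype.card_pos
  -- Half the mass sits on the estimate and half is spread uniformly: a correct guess costs at most
  -- log 2, a wrong one log 2 + log |α|.
  have h := entropy_sub_le_crossEntropy f y
    (fun b a => if u b = a then 2⁻¹ else (2 * Fintype.card α : ℝ)⁻¹)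
    (fun _ _ => by split_ifs <;> positivity)
    (fun b => by
      calc _ ≤ ∑ a, ((if u b = a then (2 : ℝ)⁻¹ else 0) + (2 * Fintype.card α : ℝ)⁻¹) := by
            refine Finset.sum_le_sum fun a _ => ?_
            split_ifs
            · simp
            · simp
        _ = 1 := by
            rw [Finset.sum_add_distrib]
            simp
            field_simp
            norm_num)
    (fun ω => by split_ifs <;> positivity)
  refine h.trans (le_of_eq ?_)
  have e : ∀ ω, -Real.log (if u (y ω) = f ω then 2⁻¹ else (2 * Fintype.card α : ℝ)⁻¹)
      = Real.log 2 + if u (y ω) ≠ f ω then Real.log (Fintype.card α) else 0 := by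
    intro ω
    by_cases hω : u (y ω) = f ω
    · simp [hω]
    · simp only [hω, if_false, ne_eq, not_false_eq_true, if_true]
      rw [Real.log_inv, Real.log_mul two_ne_zero hα.ne']
      ring
  simp only [e]
  rw [Finset.sum_add_distrib, ← Finset.sum_filter, Finset.sum_const, Finset.sum_const]
  simp only [nsmul_eq_mul, Finset.card_univ]
  field_simp

end Entropy

end CodedCaching

namespace CodedCaching

/-! ### Greedy choice of coordinates and successive decoding -/

section Coordinates

lemma restrict_eq_restrict_iff {ι α : Type*} {P : Finset ι} {ω ω' : ι → α} :
    P.restrict ω = P.restrict ω' ↔ ∀ i ∈ P, ω i = ω' i := by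
  simp [funext_iff, Finset.restrict]

variable {ι α : Type*} [Fintype ι] [DecidableEq ι] [Fintype α]

lemma entropy_restrict_le [Nonempty α] (P : Finset ι) :
    entropy (fun ω : ι → α => P.restrict ω) ≤ P.card * Real.log (Fintype.card α) := by
  refine (entropy_le_log_card _).trans (le_of_eq ?_)
  rw [Fintype.card_fun, Nat.cast_pow, Real.log_pow, Fintype.card_coe]

lemma le_entropy_restrict_univ {γ : Type*} (Z : (ι → α) → γ) :
    Fintype.card ι * Real.log (Fintype.card α)
      ≤ entropy (fun ω => ((Finset.univ : Finset ι).restrict ω, Z ω)) := by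
  have h : ∀ ω : ι → α,
      fiberCard (fun ω => ((Finset.univ : Finset ι).restrict ω, Z ω)) ω = 1 := by
    intro ω
    unfold fiberCard
    rw [Finset.card_eq_one]
    refine ⟨ω, Finset.ext fun ω' => ?_⟩
    simp only [Finset.mem_filter, Finset.mem_univ, true_and, Finset.mem_singleton, Prod.mk.injEq]
    refine ⟨fun h => funext fun i => restrict_eq_restrict_iff.1 h.1 i (Finset.mem_univ i), ?_⟩
    rintro rfl
    simp
  -- If `α` is empty, both sides vanish because `Real.log 0 = 0`.
  rcases isEmpty_or_nonempty (ι → α) with hE | hE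
  · obtain ⟨⟨i⟩, hα⟩ := isEmpty_fun.1 hE
    simp [entropy]
  · have hn : (Fintype.card (ι → α) : ℝ) ≠ 0 := by exact_mod_cast Fintype.card_ne_zero
    unfold entropy
    simp only [h]
    rw [Finset.sum_const, nsmul_eq_mul, Finset.card_univ, mul_div_cancel_left₀ _ hn,
      Fintype.card_fun, Nat.cast_pow, Nat.cast_one, div_one, Real.log_pow]

lemma entropy_insert_union_sub_le {γ : Type*} (Z : (ι → α) → γ) (P Q : Finset ι) (j : ι) :
    entropy (fun ω => ((insert j (P ∪ Q)).restrict ω, Z ω))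
        - entropy (fun ω => ((P ∪ Q).restrict ω, Z ω))
      ≤ entropy (fun ω => ((insert j P).restrict ω, Z ω))
        - entropy (fun ω => (P.restrict ω, Z ω)) := by
  have h := entropy_submodular (fun ω : ι → α => ω j) (fun ω => (P ∪ Q).restrict ω)
    (fun ω => (P.restrict ω, Z ω))
  rw [entropy_eq_of_determines (g := fun ω => ((insert j (P ∪ Q)).restrict ω, Z ω)),
    entropy_eq_of_determines (f := fun ω => ((P ∪ Q).restrict ω, P.restrict ω, Z ω))
      (g := fun ω => ((P ∪ Q).restrict ω, Z ω)),
    entropy_eq_of_determines (f := fun ω => (ω j, P.restrict ω, Z ω))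
      (g := fun ω => ((insert j P).restrict ω, Z ω))] at h
  · exact h
  all_goals
    intro ω ω'
    simp only [Prod.mk.injEq, restrict_eq_restrict_iff, Finset.mem_insert, Finset.mem_union]
    grind

lemma entropy_union_sub_le {γ : Type*} (Z : (ι → α) → γ) (P Q : Finset ι) :
    entropy (fun ω => ((P ∪ Q).restrict ω, Z ω)) - entropy (fun ω => (P.restrict ω, Z ω))
      ≤ ∑ j ∈ Q, (entropy (fun ω => ((insert j P).restrict ω, Z ω))
        - entropy (fun ω => (P.restrict ω, Z ω))) := by
  induction Q using Finset.induction_on with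
  | empty => rw [Finset.union_empty, Finset.sum_empty, sub_self]
  | insert j Q hj ih =>
    rw [Finset.sum_insert hj, Finset.union_insert]
    linarith [entropy_insert_union_sub_le Z P Q j]

/-- Some coordinate outside `P` has at least the average conditional entropy. -/
lemma exists_insert_entropy_ge {γ : Type*} (Z : (ι → α) → γ) {P : Finset ι}
    (hP : P ≠ Finset.univ) :
    ∃ j ∉ P, entropy (fun ω => ((Finset.univ : Finset ι).restrict ω, Z ω))
        - entropy (fun ω => (P.restrict ω, Z ω))
      ≤ ((Fintype.card ι : ℝ) - P.card) * (entropy (fun ω => ((insert j P).restrict ω, Z ω))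
        - entropy (fun ω => (P.restrict ω, Z ω))) := by
  have hne : Pᶜ.Nonempty := by
    rwa [Finset.nonempty_iff_ne_empty, ne_eq, Finset.compl_eq_empty_iff]
  have hc : ((Pᶜ).card : ℝ) = (Fintype.card ι : ℝ) - P.card := by
    rw [Finset.card_compl, Nat.cast_sub (Finset.card_le_univ P)]
  have hpos : (0 : ℝ) < (Pᶜ).card := by exact_mod_cast hne.card_pos
  have h := entropy_union_sub_le Z P Pᶜ
  rw [Finset.union_compl] at h
  obtain ⟨j, hj, hle⟩ := Finset.exists_le_of_sum_le (s := Pᶜ)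
    (f := fun _ => (entropy (fun ω => ((Finset.univ : Finset ι).restrict ω, Z ω))
        - entropy (fun ω => (P.restrict ω, Z ω))) / (Pᶜ).card)
    (g := fun j => entropy (fun ω => ((insert j P).restrict ω, Z ω))
        - entropy (fun ω => (P.restrict ω, Z ω))) hne
    (by rwa [Finset.sum_const, nsmul_eq_mul, mul_div_cancel₀ _ hpos.ne'])
  refine ⟨j, Finset.mem_compl.1 hj, ?_⟩
  rw [← hc, mul_comm]
  exact (div_le_iff₀ hpos).1 hle

/-- The side information may change at every step, since each choice compares only the coordinates
still missing under the current `C k`. -/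
lemma exists_greedy_sequence [Nonempty ι] {γ : ℕ → Type*} (C : ∀ k, (ι → α) → γ k) :
    ∃ (e : ℕ → ι) (P : ℕ → Finset ι), P 0 = ∅ ∧ (∀ k, P (k + 1) = insert (e k) (P k)) ∧
      (∀ k ≤ Fintype.card ι, (P k).card = k) ∧
      ∀ k < Fintype.card ι,
        entropy (fun ω => ((Finset.univ : Finset ι).restrict ω, C k ω))
          - entropy (fun ω => ((P k).restrict ω, C k ω))
        ≤ ((Fintype.card ι : ℝ) - k) * (entropy (fun ω => ((P (k + 1)).restrict ω, C k ω))
          - entropy (fun ω => ((P k).restrict ω, C k ω))) := by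
  have hex : ∀ (k : ℕ) (P : Finset ι), ∃ j, P ≠ Finset.univ → j ∉ P ∧
      entropy (fun ω => ((Finset.univ : Finset ι).restrict ω, C k ω))
          - entropy (fun ω => (P.restrict ω, C k ω))
        ≤ ((Fintype.card ι : ℝ) - P.card) * (entropy (fun ω => ((insert j P).restrict ω, C k ω))
          - entropy (fun ω => (P.restrict ω, C k ω))) := by
    intro k P
    by_cases hP : P = Finset.univ
    · exact ⟨Classical.arbitrary ι, fun h => absurd hP h⟩
    · obtain ⟨j, hj⟩ := exists_insert_entropy_ge (C k) hP
      exact ⟨j, fun _ => hj⟩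
  choose nxt hnxt using hex
  let P : ℕ → Finset ι := fun k => Nat.rec ∅ (fun k Q => insert (nxt k Q) Q) k
  have hsucc : ∀ k, P (k + 1) = insert (nxt k (P k)) (P k) := fun k => rfl
  have hne : ∀ k < Fintype.card ι, (P k).card = k → P k ≠ Finset.univ := by
    intro k hk hc hP
    rw [hP, Finset.card_univ] at hc
    omega
  have hcard : ∀ k ≤ Fintype.card ι, (P k).card = k := by
    intro k
    induction k with
    | zero => intro _; rfl
    | succ k ih =>
      intro hk
      have hk' := ih (by omega)
      rw [hsucc, Finset.card_insert_of_notMem (hnxt k (P k) (hne k (by omega) hk')).1, hk']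
  refine ⟨fun k => nxt k (P k), P, rfl, hsucc, hcard, fun k hk => ?_⟩
  have h := (hnxt k (P k) (hne k hk (hcard k hk.le))).2
  rwa [hcard k hk.le] at h

/-- If coordinate `e k` is nearly determined by `X` and the side information `C k`, which
grows with `k`, then the entropy of `X` is bounded below by the accumulated conditional
entropies of the coordinates. -/
lemma sum_condEntropy_le [Nonempty α] {ξ : Type*} [Fintype ξ] {γ : ℕ → Type*}
    (X : (ι → α) → ξ) (C : ∀ k, (ι → α) → γ k) (e : ℕ → ι) (P : ℕ → Finset ι) (δ : ℝ) (s : ℕ)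
    (hP : ∀ k, P (k + 1) = insert (e k) (P k))
    (hC : ∀ k ω ω', C (k + 1) ω = C (k + 1) ω' → C k ω = C k ω')
    (hX : ∀ k < s, entropy (fun ω => (ω (e k), X ω, C k ω))
      - entropy (fun ω => (X ω, C k ω)) ≤ δ) :
    ∑ k ∈ Finset.range s, (entropy (fun ω => ((P (k + 1)).restrict ω, C k ω))
      - entropy (fun ω => ((P k).restrict ω, C k ω)) - δ) ≤ entropy X := by
  -- Invariant: H(X | P t, C t) plus the entropies collected so far is at most H(X).
  suffices H : ∀ t ≤ s, entropy (fun ω => (X ω, (P t).restrict ω, C t ω))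
      - entropy (fun ω => ((P t).restrict ω, C t ω))
      + ∑ k ∈ Finset.range t, (entropy (fun ω => ((P (k + 1)).restrict ω, C k ω))
        - entropy (fun ω => ((P k).restrict ω, C k ω)) - δ) ≤ entropy X by
    have h1 := H s le_rfl
    have h2 : entropy (fun ω => ((P s).restrict ω, C s ω))
        ≤ entropy (fun ω => (X ω, (P s).restrict ω, C s ω)) :=
      entropy_le_of_determines fun ω ω' h => (Prod.ext_iff.1 h).2
    linarith
  intro t
  induction t with
  | zero =>
    intro _
    have := entropy_pair_le X (fun ω => ((P 0).restrict ω, C 0 ω))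
    rw [Finset.sum_range_zero]
    linarith
  | succ k ih =>
    intro hk
    rw [Finset.sum_range_succ]
    have h0 := ih (by omega)
    -- Enlarging the side information can only lower the conditional entropy of `X`.
    have h1 := entropy_submodular X (C (k + 1)) (fun ω => ((P (k + 1)).restrict ω, C k ω))
    rw [entropy_eq_of_determines (g := fun ω => (X ω, (P (k + 1)).restrict ω, C (k + 1) ω)),
      entropy_eq_of_determines (f := fun ω => (C (k + 1) ω, (P (k + 1)).restrict ω, C k ω))
        (g := fun ω => ((P (k + 1)).restrict ω, C (k + 1) ω))] at h1
    -- Given `X` and `C k`, coordinate `e k` has entropy at most `δ`; also knowing `P k` keeps it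
    -- so.
    · have h2 := entropy_submodular (fun ω : ι → α => ω (e k)) (fun ω => (P k).restrict ω)
        (fun ω => (X ω, C k ω))
      rw [entropy_eq_of_determines (g := fun ω => (X ω, (P (k + 1)).restrict ω, C k ω)),
        entropy_eq_of_determines (f := fun ω => ((P k).restrict ω, X ω, C k ω))
          (g := fun ω => (X ω, (P k).restrict ω, C k ω))] at h2
      · linarith [hX k (by omega)]
      all_goals
        intro ω ω'
        simp only [Prod.mk.injEq, restrict_eq_restrict_iff, hP, Finset.mem_insert]
        grind
    all_goals
      intro ω ω'
      simp only [Prod.mk.injEq]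
      have := hC k ω ω'
      tauto

end Coordinates

end CodedCaching

/-! ### Unicast achievability -/

namespace CodedCaching

/-- Unicasting every requested file achieves the load `K`. -/
lemma achievable_card_users (K N : ℕ) (m : Fin K → ℝ) : Achievable K N m K := by
  classical
  intro ε hε
  refine Eventually.of_forall fun F => ?_
  let single : Fin K → UserGroup K := fun k => ⟨{k}, Finset.singleton_nonempty k⟩
  have hinj : Function.Injective single := fun i j h =>
    Finset.singleton_injective (congrArg Subtype.val h)
  let v : UserGroup K → ℝ := fun T => if T ∈ Finset.univ.image single then 1 else 0
  have hv : ∀ k, 2 ^ F = 2 ^ ⌊v (single k) * (F : ℝ)⌋₊ := fun k => by simp [v]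
  let S : CachingScheme K N F m v :=
    { placement := fun k _ => ⟨0, by positivity⟩
      encode := fun T _ w =>
        if h : ∃ k, T = single k then
          Fin.cast (by rw [hv h.choose, ← h.choose_spec]) (w h.choose)
        else ⟨0, by positivity⟩
      decode := fun _ k X _ => Fin.cast (hv k).symm (X (single k)) }
  refine ⟨v, fun T => by simp only [v]; split_ifs <;> norm_num, ?_, S, fun d k => ?_⟩
  · simp only [v]
    rw [← Finset.sum_filter, Finset.filter_mem_eq_inter, Finset.univ_inter,
      Finset.sum_const, Finset.card_image_of_injective _ hinj]
    simp
  · have hout : ∀ W, S.output d k W = W (d k) := by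
      intro W
      have hex : ∃ j, single k = single j := ⟨k, rfl⟩
      have hj : hex.choose = k := (hinj hex.choose_spec).symm
      apply Fin.ext
      simp only [CachingScheme.output, S, Fin.val_cast, dif_pos hex]
      rw [hj]
    simp [CachingScheme.errorProb, hout, hε.le]

/-! ### Converse bounds for a fixed scheme -/

namespace CachingScheme

variable {K N F : ℕ} {m : Fin K → ℝ} {v : UserGroup K → ℝ}

/-- All signals, as a function of the library. -/
def signals (S : CachingScheme K N F m v) (d : Fin K → Fin N) (W : Library N F) :
    (T : UserGroup K) → Fin (2 ^ ⌊v T * (F : ℝ)⌋₊) :=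
  fun T => S.encode T d (fun j => W (d j))

/-- The cache contents of the users in `A`. -/
def caches (S : CachingScheme K N F m v) (A : Finset (Fin K)) (W : Library N F) :
    (i : A) → Fin (2 ^ ⌊(N : ℝ) * m i * (F : ℝ)⌋₊) :=
  fun i => S.placement i W

lemma log_card_fin_two_pow (n : ℕ) :
    Real.log (Fintype.card (Fin (2 ^ n))) = n * Real.log 2 := by
  rw [Fintype.card_fin, Nat.cast_pow, Real.log_pow, Nat.cast_ofNat]

lemma log_card_pi_fin_two_pow_floor_le {ι : Type*} [Fintype ι] [DecidableEq ι] {x : ι → ℝ}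
    (hx : ∀ i, 0 ≤ x i) :
    Real.log (Fintype.card ((i : ι) → Fin (2 ^ ⌊x i⌋₊))) ≤ (∑ i, x i) * Real.log 2 := by
  rw [Fintype.card_pi, Nat.cast_prod, Real.log_prod (fun i _ => by simp), Finset.sum_mul]
  refine Finset.sum_le_sum fun i _ => ?_
  rw [log_card_fin_two_pow]
  have := Nat.floor_le (hx i)
  have := Real.log_nonneg one_le_two
  gcongr

lemma entropy_signals_le (S : CachingScheme K N F m v) (d : Fin K → Fin N)
    (hv : ∀ T, 0 ≤ v T) : entropy (S.signals d) ≤ (∑ T, v T) * (F * Real.log 2) := by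
  classical
  refine (entropy_le_log_card _).trans ?_
  refine (log_card_pi_fin_two_pow_floor_le fun T => mul_nonneg (hv T) F.cast_nonneg).trans ?_
  rw [← Finset.sum_mul, mul_assoc]

lemma entropy_caches_le (S : CachingScheme K N F m v) (A : Finset (Fin K))
    (hm : ∀ k, 0 ≤ m k) : entropy (S.caches A) ≤ N * (∑ i ∈ A, m i) * (F * Real.log 2) := by
  classical
  refine (entropy_le_log_card _).trans ?_
  refine (log_card_pi_fin_two_pow_floor_le
    fun i : A => mul_nonneg (mul_nonneg N.cast_nonneg (hm i)) F.cast_nonneg).trans ?_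
  rw [← Finset.sum_mul, ← Finset.mul_sum, mul_assoc _ (F : ℝ) _, Finset.sum_coe_sort A m]

/-- Since `k ∈ A`, the decoder of user `k` is a function of the signals and the caches in `A`, so
Fano applies. -/
lemma entropy_demand_sub_le (S : CachingScheme K N F m v) (d : Fin K → Fin N) (k : Fin K)
    {A : Finset (Fin K)} (hk : k ∈ A) {ε : ℝ} (hε : S.errorProb d k ≤ ε) :
    entropy (fun W => (W (d k), S.signals d W, S.caches A W))
      - entropy (fun W => (S.signals d W, S.caches A W))
      ≤ Real.log 2 + ε * (F * Real.log 2) := by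
  classical
  refine (fano (fun W : Library N F => W (d k)) (fun W => (S.signals d W, S.caches A W))
    (fun y => S.decode d k y.1 (y.2 ⟨k, hk⟩))).trans ?_
  rw [log_card_fin_two_pow]
  have := Real.log_nonneg one_le_two
  gcongr
  refine le_trans (le_of_eq ?_) hε
  unfold errorProb
  congr!

/-- The converse for sequential decoding by the users `0, …, s - 1`, where user `k` is granted
the caches in `A k`, along a greedily chosen demand sequence. -/
lemma exists_greedy_demands (S : CachingScheme K N F m v) (hN : 1 ≤ N) {s : ℕ} (hsK : s ≤ K)
    (hv : ∀ T, 0 ≤ v T) {ε : ℝ} (hε : ∀ d k, S.errorProb d k ≤ ε) (A : ℕ → Finset (Fin K))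
    (hA : Monotone A) (hmem : ∀ k : Fin K, k.val < s → k ∈ A k) :
    ∃ P : ℕ → Finset (Fin N), P 0 = ∅ ∧ (∀ k ≤ N, (P k).card = k) ∧
      (∀ k < N,
        entropy (fun W => ((Finset.univ : Finset (Fin N)).restrict W, S.caches (A k) W))
          - entropy (fun W => ((P k).restrict W, S.caches (A k) W))
        ≤ ((N : ℝ) - k) * (entropy (fun W => ((P (k + 1)).restrict W, S.caches (A k) W))
          - entropy (fun W => ((P k).restrict W, S.caches (A k) W)))) ∧
      ∑ k ∈ Finset.range s, (entropy (fun W => ((P (k + 1)).restrict W, S.caches (A k) W))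
        - entropy (fun W => ((P k).restrict W, S.caches (A k) W)))
        ≤ (∑ T, v T) * (F * Real.log 2) + s * (Real.log 2 + ε * (F * Real.log 2)) := by
  have : Nonempty (Fin N) := ⟨⟨0, hN⟩⟩
  obtain ⟨e, P, hP0, hP, hcard, hgr⟩ := exists_greedy_sequence (fun k => S.caches (A k))
  rw [Fintype.card_fin] at hcard hgr
  refine ⟨P, hP0, hcard, hgr, ?_⟩
  -- User `i` demands the greedy file `e i`. This vector depends on the placement, which is harmless
  -- because `hε` covers all demands.
  have h := sum_condEntropy_le (S.signals fun i => e i) (fun k => S.caches (A k)) e P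
    (Real.log 2 + ε * (F * Real.log 2)) s hP
    (fun k W W' h => funext fun i =>
      congrFun h ⟨i.1, hA (Nat.le_succ k) i.2⟩)
    (fun k hk => S.entropy_demand_sub_le (fun i => e i) ⟨k, by omega⟩ (hmem ⟨k, by omega⟩ hk)
      (hε _ _))
  rw [Finset.sum_sub_distrib, Finset.sum_const, Finset.card_range, nsmul_eq_mul] at h
  linarith [S.entropy_signals_le (fun i => e i) hv]

/-- In units of `F` bits, the whole library has entropy N, while `k` files and the first `k + 1`
caches carry at most `k + N * cacheSum m (k + 1)`. Dividing the difference by the `N - k` remaining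
files bounds each greedy increment. -/
lemma sequential_bound (S : CachingScheme K N F m v) (hN : 1 ≤ N) {s : ℕ} (hsK : s ≤ K)
    (hsN : s ≤ N) (hm : ∀ k, 0 ≤ m k) (hv : ∀ T, 0 ≤ v T) {ε : ℝ}
    (hε : ∀ d k, S.errorProb d k ≤ ε) :
    ((s : ℝ) - ∑ k ∈ Finset.Icc 1 s, (N : ℝ) * cacheSum m k / ((N : ℝ) - (k : ℝ) + 1))
        * (F * Real.log 2)
      ≤ (∑ T, v T) * (F * Real.log 2) + s * (Real.log 2 + ε * (F * Real.log 2)) := by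
  obtain ⟨P, -, hcard, hgr, hsum⟩ := S.exists_greedy_demands hN hsK hv hε
    (fun k => Finset.univ.filter fun i : Fin K => i.val < k + 1)
    (fun a b hab i => by
      simp only [Finset.mem_filter, Finset.mem_univ, true_and]
      omega) (fun k _ => by simp)
  refine le_trans ?_ hsum
  -- Shift to 0-based users: N - (k + 1) + 1 = N - k.
  have e1 : ((s : ℝ) - ∑ k ∈ Finset.Icc 1 s, (N : ℝ) * cacheSum m k / ((N : ℝ) - (k : ℝ) + 1))
      = ∑ k ∈ Finset.range s, (1 - (N : ℝ) * cacheSum m (k + 1) / ((N : ℝ) - k)) := by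
    rw [Finset.sum_sub_distrib, Finset.sum_const, Finset.card_range, nsmul_eq_mul, mul_one,
      ← Finset.Ico_add_one_right_eq_Icc, Finset.sum_Ico_eq_sum_range]
    congr 1
    refine Finset.sum_congr (by simp) fun k _ => ?_
    rw [add_comm 1 k]
    push_cast
    congr 1
    ring
  rw [e1, Finset.sum_mul]
  refine Finset.sum_le_sum fun k hk => ?_
  have hks : k < s := Finset.mem_range.1 hk
  have hpos : (0 : ℝ) < (N : ℝ) - k := sub_pos.mpr (by exact_mod_cast hks.trans_le hsN)
  have hg := hgr k (by omega)
  have hall := le_entropy_restrict_univ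
    (S.caches (Finset.univ.filter fun i : Fin K => i.val < k + 1))
  have hpair := entropy_pair_le (fun W : Library N F => (P k).restrict W)
    (S.caches (Finset.univ.filter fun i : Fin K => i.val < k + 1))
  have hres := entropy_restrict_le (α := Fin (2 ^ F)) (P k)
  have hca := S.entropy_caches_le (Finset.univ.filter fun i : Fin K => i.val < k + 1) hm
  rw [hcard k (by omega)] at hres
  rw [log_card_fin_two_pow] at hres hall
  rw [Fintype.card_fin] at hall
  have hc : cacheSum m (k + 1) = ∑ i : Fin K with i.val < k + 1, m i := rfl
  rw [← hc] at hca
  rw [show (1 - (N : ℝ) * cacheSum m (k + 1) / ((N : ℝ) - k)) * (F * Real.log 2)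
    = (((N : ℝ) - k) * (F * Real.log 2) - N * cacheSum m (k + 1) * (F * Real.log 2))
      / ((N : ℝ) - k) by field_simp, div_le_iff₀ hpos]
  linarith

/-- The hypothesis `h` moves `a` towards `c` by a fraction 1/(n - p) of the gap, so a share p/n of
`c` grows to at least (p + 1)/n. -/
lemma averaging_step {p n a b c : ℝ} (hn : 0 < n) (hpn : p + 1 ≤ n)
    (ha : p * c ≤ n * a) (h : c - a ≤ (n - p) * (b - a)) : (p + 1) * c ≤ n * b := by
  have h1 : 0 ≤ (n - p - 1) * (n * a - p * c) :=
    mul_nonneg (by linarith) (by linarith)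
  have h2 := mul_le_mul_of_nonneg_left h hn.le
  refine le_of_mul_le_mul_left (a := n - p) ?_ (by linarith)
  linarith

/-- With all `s` caches granted throughout, greedy choice gives `s` files at least the share s/N of
the library's entropy given those caches, which is at least `N * (1 - cacheSum m s)` in units of `F`
bits. -/
lemma cutset_bound (S : CachingScheme K N F m v) (hN : 1 ≤ N) {s : ℕ} (hsK : s ≤ K)
    (hsN : s ≤ N) (hm : ∀ k, 0 ≤ m k) (hv : ∀ T, 0 ≤ v T) {ε : ℝ}
    (hε : ∀ d k, S.errorProb d k ≤ ε) :
    ((s : ℝ) * (1 - cacheSum m s)) * (F * Real.log 2)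
      ≤ (∑ T, v T) * (F * Real.log 2) + s * (Real.log 2 + ε * (F * Real.log 2)) := by
  obtain ⟨P, hP0, -, hgr, hsum⟩ := S.exists_greedy_demands hN hsK hv hε
    (fun _ => Finset.univ.filter fun i : Fin K => i.val < s)
    monotone_const (fun k hk => by simpa using hk)
  refine le_trans ?_ hsum
  rw [Finset.sum_range_sub (fun k => entropy (fun W => ((P k).restrict W,
    S.caches (Finset.univ.filter fun i : Fin K => i.val < s) W)))]
  have hNpos : (0 : ℝ) < N := by exact_mod_cast hN
  have havg : ∀ t ≤ N, (t : ℝ) * (entropy (fun W => ((Finset.univ : Finset (Fin N)).restrict W,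
        S.caches (Finset.univ.filter fun i : Fin K => i.val < s) W))
        - entropy (fun W => ((P 0).restrict W,
          S.caches (Finset.univ.filter fun i : Fin K => i.val < s) W)))
      ≤ N * (entropy (fun W => ((P t).restrict W,
        S.caches (Finset.univ.filter fun i : Fin K => i.val < s) W))
        - entropy (fun W => ((P 0).restrict W,
          S.caches (Finset.univ.filter fun i : Fin K => i.val < s) W))) := by
    intro t
    induction t with
    | zero => simp
    | succ t ih =>
      intro ht
      have := hgr t (by omega)
      rw [Nat.cast_succ]
      exact averaging_step hNpos (by exact_mod_cast ht) (ih (by omega)) (by linarith)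
  have h1 := havg s hsN
  have hall := le_entropy_restrict_univ
    (S.caches (Finset.univ.filter fun i : Fin K => i.val < s))
  rw [log_card_fin_two_pow, Fintype.card_fin] at hall
  have hca := S.entropy_caches_le (Finset.univ.filter fun i : Fin K => i.val < s) hm
  have hc : cacheSum m s = ∑ i : Fin K with i.val < s, m i := rfl
  rw [← hc] at hca
  have h0 : entropy (fun W => ((P 0).restrict W,
      S.caches (Finset.univ.filter fun i : Fin K => i.val < s) W))
      ≤ entropy (S.caches (Finset.univ.filter fun i : Fin K => i.val < s)) := by
    refine entropy_le_of_determines fun W W' h => ?_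
    simp only [Prod.mk.injEq, restrict_eq_restrict_iff, hP0]
    exact ⟨by simp, h⟩
  refine le_of_mul_le_mul_left (le_trans (le_trans (le_of_eq ?_)
    (mul_le_mul_of_nonneg_left (a := (s : ℝ)) (sub_le_sub hall (h0.trans hca))
      s.cast_nonneg)) h1) hNpos
  ring

end CachingScheme

/-! ### Large-file limit and conclusion -/

lemma le_of_achievable {K N s : ℕ} {m : Fin K → ℝ} {R B : ℝ} (hR : Achievable K N m R)
    (hB : ∀ (F : ℕ) (v : UserGroup K → ℝ) (S : CachingScheme K N F m v) (ε : ℝ),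
      (∀ T, 0 ≤ v T) → (∀ d k, S.errorProb d k ≤ ε) →
      B * (F * Real.log 2)
        ≤ (∑ T, v T) * (F * Real.log 2) + s * (Real.log 2 + ε * (F * Real.log 2))) :
    B ≤ R := by
  refine le_of_forall_pos_le_add fun η hη => ?_
  -- Once `F ≥ 1/ε`, the log 2 term is at most `ε * F * log 2`; the factor 2 covers both error
  -- terms, and `s + 1` keeps the denominator nonzero.
  set ε : ℝ := η / (2 * (s + 1)) with hεdef
  have hε : 0 < ε := by positivity
  obtain ⟨F, ⟨v, hv, rfl, S, hS⟩, hF⟩ :=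
    ((hR ε hε).and (eventually_ge_atTop (⌈ε⁻¹⌉₊))).exists
  have hF' : ε⁻¹ ≤ F := Nat.ceil_le.1 hF
  have hFpos : (0 : ℝ) < F := lt_of_lt_of_le (by positivity) hF'
  have h1 : 1 ≤ ε * F := by
    rwa [inv_le_iff_one_le_mul₀ hε, mul_comm] at hF'
  have h := hB F v S ε hv hS
  have hlog := Real.log_pos one_lt_two
  have h2 : (s : ℝ) * (Real.log 2 + ε * (F * Real.log 2)) ≤ η * (F * Real.log 2) := by
    calc (s : ℝ) * (Real.log 2 + ε * (F * Real.log 2))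
        ≤ s * (ε * F * Real.log 2 + ε * (F * Real.log 2)) := by
          gcongr
          exact le_mul_of_one_le_left hlog.le h1
      _ = s * (2 * ε) * (F * Real.log 2) := by ring
      _ ≤ η * (F * Real.log 2) := by
          gcongr
          rw [hεdef]
          have : (s : ℝ) * (2 * (η / (2 * (s + 1)))) = η * (s / (s + 1)) := by field_simp
          rw [this]
          exact mul_le_of_le_one_right hη.le (div_le_one_of_le₀ (by linarith) (by positivity))
  refine le_of_mul_le_mul_right (a := F * Real.log 2) ?_ (by positivity)
  linarith

end CodedCaching

open CodedCaching in
theorem mainTheorem9 (K N : ℕ) (hK : 1 ≤ K) (hN : 1 ≤ N) (m : Fin K → ℝ)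
    (hm01 : ∀ k, m k ∈ Set.Icc (0 : ℝ) 1) (hm : Monotone m) :
    max
      ((Finset.Icc 1 (min K N)).sup' (Finset.nonempty_Icc.mpr (le_min hK hN))
        (fun s : ℕ => (s : ℝ) - ∑ k ∈ Finset.Icc 1 s,
          (N : ℝ) * CodedCaching.cacheSum m k / ((N : ℝ) - (k : ℝ) + 1)))
      ((Finset.Icc 1 (min K N)).sup' (Finset.nonempty_Icc.mpr (le_min hK hN))
        (fun s : ℕ => (s : ℝ) * (1 - CodedCaching.cacheSum m s)))
      ≤ CodedCaching.optimalLoad K N m := by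
  -- Unicasting makes the set of achievable loads nonempty; the real `sInf` of an empty set would be
  -- 0.
  refine le_csInf ⟨K, achievable_card_users K N m⟩ fun R hR => ?_
  refine max_le (Finset.sup'_le _ _ fun s hs => ?_) (Finset.sup'_le _ _ fun s hs => ?_) <;>
    obtain ⟨hsK, hsN⟩ := le_min_iff.1 (Finset.mem_Icc.1 hs).2
  · exact le_of_achievable hR fun F v S ε hv hε =>
      S.sequential_bound hN hsK hsN (fun k => (hm01 k).1) hv hε
  · exact le_of_achievable hR fun F v S ε hv hε =>
      S.cutset_bound hN hsK hsN (fun k => (hm01 k).1) hv hε
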